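/- Let $\mathcal G=(I,E)$ be a finite directed acyclic graph with $|I|=m$, and let $c$ be a colouring of its vertices and edges that is compatible: vertex colours and edge colours are disjoint, and edges $j\to i$, $l\to k$ of the same colour have children $i,k$ of the same colour. The RDAG model on $(\mathcal G,c)$ is the set of concentration matrices $\Psi=(\mathrm{id}-\Lambda)^{\mathsf T}\Omega^{-1}(\mathrm{id}-\Lambda)$, where $\Lambda\in\mathbb R^{m\times m}$ satisfies $\lambda_{ij}=0$ unless $j\to i$ and $\lambda_{ij}=\lambda_{kl}$ whenever the edges $j\to i$ and $l\to k$ have the same colour, and $\Omega$ is diagonal with positive entries satisfying $\omega_{ii}=\omega_{kk}$ whenever the vertices $i$ and $k$ have the same colour. Let $A$ be the set of real $m\times m$ matrices $a$ with $\det(a)=1$, with $a_{ij}=0$ whenever $i\neq j$ and $j\to i$ is not an edge, and with $a_{ij}=a_{kl}$ whenever $c(ij)=c(kl)$; here $c(ij)$ denotes the colour of the edge $j\to i$ if $i\ne j$ and of the vertex $i$ if $i=j$. Let $n\ge 1$ and let $Y\in\mathbb R^{m\times n}$ be a matrix whose columns are $n$ independent samples from a centred Gaussian distribution; an MLE given $Y$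 is a matrix in the RDAG model that maximises the Gaussian likelihood of $Y$ over the model. Put $A_Y=\{b\in A\mid bY=Y\}$. If $\lambda a^{\mathsf T}a$ is an MLE given $Y$, where $a\in A$ and $\lambda>0$ is a scalar, then $$b\longmapsto \lambda\,(a+b-\mathrm{id})^{\mathsf T}(a+b-\mathrm{id})$$ is a bijection from $A_Y$ onto the set of MLEs given $Y$. -/

import Mathlib

/-- A coloured directed acyclic graph on the vertex set `I` with colours in `C`.
`Adj j i` means that there is an edge `j → i`; a vertex `i` has colour `vertexColour i`
and an edge `h : j → i` has colour `edgeColour h`. -/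
structure ColouredDAG (I : Type*) (C : Type*) extends Digraph I where
  /-- There is no directed cycle (in particular no loop). -/
  acyclic : ∀ i, ¬ Relation.TransGen Adj i i
  vertexColour : I → C
  edgeColour : ∀ ⦃j i : I⦄, Adj j i → C

namespace ColouredDAG

variable {I C : Type*}

/-- The matrix position `(i, j)` has colour `s`: either `i = j` is a vertex of colour `s`, or
`j → i` is an edge of colour `s`. -/
def HasColour (G : ColouredDAG I C) (i j : I) (s : C) : Prop :=
  (i = j ∧ G.vertexColour i = s) ∨ ∃ h : G.Adj j i, G.edgeColour h = s

/-- A colouring is compatible if vertex and edge colours are disjoint, and edges of the same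
colour have children of the same colour. -/
structure Compatible (G : ColouredDAG I C) : Prop where
  disjoint : ∀ (v : I) ⦃j i : I⦄ (h : G.Adj j i), G.vertexColour v ≠ G.edgeColour h
  child : ∀ ⦃j i l k : I⦄ (h : G.Adj j i) (h' : G.Adj l k),
    G.edgeColour h = G.edgeColour h' → G.vertexColour i = G.vertexColour k

/-- The RDAG model: all concentration matrices `(id - Λ)ᵀ Ω⁻¹ (id - Λ)`, where `Λ` is supported on
the edges and constant on edge colours, and `Ω` is diagonal with positive entries that are constant
on vertex colours. -/
def rdagModel [Fintype I] [DecidableEq I] (G : ColouredDAG I C) : Set (Matrix I I ℝ) :=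
  {Ψ | ∃ (Λ : Matrix I I ℝ) (ω : I → ℝ),
    (∀ i j, ¬ G.Adj j i → Λ i j = 0) ∧
    (∀ ⦃j i l k : I⦄ (h : G.Adj j i) (h' : G.Adj l k),
      G.edgeColour h = G.edgeColour h' → Λ i j = Λ k l) ∧
    (∀ i, 0 < ω i) ∧
    (∀ i j, G.vertexColour i = G.vertexColour j → ω i = ω j) ∧
    Ψ = (1 - Λ).transpose * (Matrix.diagonal ω)⁻¹ * (1 - Λ)}

/-- The set `A(G, c)` of invertible matrices with `a i j = 0` if `i ≠ j` and `j → i` is not an edge,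
and with equal entries at positions of equal colour. -/
def matrixSet [Fintype I] [DecidableEq I] (G : ColouredDAG I C) : Set (Matrix I I ℝ) :=
  {a | IsUnit a ∧
    (∀ i j, i ≠ j → ¬ G.Adj j i → a i j = 0) ∧
    (∀ i j k l s, G.HasColour i j s → G.HasColour k l s → a i j = a k l)}

/-- The set `A(G, c)_SL` of matrices of determinant one in `A(G, c)`. -/
def matrixSetSL [Fintype I] [DecidableEq I] (G : ColouredDAG I C) : Set (Matrix I I ℝ) :=
  {a | a ∈ G.matrixSet ∧ a.det = 1}

end ColouredDAG

/-- The stabilising set `A_Y = {a ∈ A | a Y = Y}` of a sample matrix `Y`. -/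
def stabilisingSet {I : Type*} [Fintype I] {n : ℕ} (A : Set (Matrix I I ℝ))
    (Y : Matrix I (Fin n) ℝ) : Set (Matrix I I ℝ) :=
  {a | a ∈ A ∧ a * Y = Y}

/-- The density at `y` of the centred Gaussian distribution with concentration matrix `Ψ`. -/
noncomputable def gaussianDensity {I : Type*} [Fintype I] [DecidableEq I]
    (Ψ : Matrix I I ℝ) (y : I → ℝ) : ℝ :=
  1 / √((2 * Real.pi) • Ψ⁻¹).det * Real.exp (-(1 / 2) * (y ⬝ᵥ Matrix.mulVec Ψ y))

/-- The likelihood of `Ψ` given the independent samples that are the columns of `Y`. -/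
noncomputable def likelihood {I : Type*} [Fintype I] [DecidableEq I] {n : ℕ}
    (Y : Matrix I (Fin n) ℝ) (Ψ : Matrix I I ℝ) : ℝ :=
  ∏ t : Fin n, gaussianDensity Ψ (fun i => Y i t)

/-- `Ψ` is a maximum likelihood estimate given `Y` in the Gaussian model `M`, a set of
concentration matrices. -/
def IsMLE {I : Type*} [Fintype I] [DecidableEq I] {n : ℕ} (M : Set (Matrix I I ℝ))
    (Y : Matrix I (Fin n) ℝ) (Ψ : Matrix I I ℝ) : Prop :=
  Ψ ∈ M ∧ ∀ Φ ∈ M, likelihood Y Φ ≤ likelihood Y Ψ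

open Matrix

namespace ColouredDAG

variable {I C : Type*}

/-- A vertex has strictly more ancestors than each of its parents. -/
theorem exists_depth [Finite I] (G : ColouredDAG I C) :
    ∃ f : I → ℕ, ∀ ⦃j i⦄, G.Adj j i → f j < f i := by
  refine ⟨fun i => {k | Relation.TransGen G.Adj k i}.ncard, fun j i h => ?_⟩
  refine Set.ncard_lt_ncard ⟨fun k hk => Relation.TransGen.tail hk h, fun hsub => ?_⟩ (Set.toFinite _)
  exact G.acyclic j (hsub (Relation.TransGen.single h))

theorem ne_of_adj (G : ColouredDAG I C) {j i : I} (h : G.Adj j i) : i ≠ j := by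
  rintro rfl
  exact G.acyclic i (Relation.TransGen.single h)

/-- The linear space of matrices supported on the diagonal and the edges, with equal entries at
positions of equal colour. -/
def patternSpace (G : ColouredDAG I C) : Submodule ℝ (Matrix I I ℝ) where
  carrier := {a | (∀ i j, i ≠ j → ¬ G.Adj j i → a i j = 0) ∧
    ∀ i j k l s, G.HasColour i j s → G.HasColour k l s → a i j = a k l}
  zero_mem' := ⟨fun _ _ _ _ => rfl, fun _ _ _ _ _ _ _ => rfl⟩
  add_mem' {a b} ha hb := by
    refine ⟨fun i j h h' => ?_, fun i j k l s h h' => ?_⟩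
    · rw [Matrix.add_apply, ha.1 i j h h', hb.1 i j h h', add_zero]
    · rw [Matrix.add_apply, Matrix.add_apply, ha.2 i j k l s h h', hb.2 i j k l s h h']
  smul_mem' c a ha := by
    refine ⟨fun i j h h' => ?_, fun i j k l s h h' => ?_⟩
    · rw [Matrix.smul_apply, ha.1 i j h h', smul_zero]
    · rw [Matrix.smul_apply, Matrix.smul_apply, ha.2 i j k l s h h']

theorem diag_eq_of_mem_patternSpace {G : ColouredDAG I C} {a : Matrix I I ℝ}
    (ha : a ∈ G.patternSpace) {i k : I} (h : G.vertexColour i = G.vertexColour k) :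
    a i i = a k k :=
  ha.2 i i k k _ (Or.inl ⟨rfl, rfl⟩) (Or.inl ⟨rfl, h.symm⟩)

theorem exists_adj_of_ne {G : ColouredDAG I C} {i j : I} {s : C}
    (h : G.HasColour i j s) (hij : i ≠ j) : ∃ h : G.Adj j i, G.edgeColour h = s :=
  h.resolve_left fun h => hij h.1

/-- Positions of equal colour are both diagonal or both edges, and their rows have equal colour. -/
theorem Compatible.of_hasColour {G : ColouredDAG I C} (hG : G.Compatible) {i j k l : I} {s : C}
    (h : G.HasColour i j s) (h' : G.HasColour k l s) :
    (i = j ↔ k = l) ∧ G.vertexColour i = G.vertexColour k := by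
  rcases h with ⟨rfl, h⟩ | ⟨e, h⟩ <;> rcases h' with ⟨rfl, h'⟩ | ⟨e', h'⟩
  · exact ⟨by simp, h.trans h'.symm⟩
  · exact absurd (h.trans h'.symm) (hG.disjoint _ e')
  · exact absurd (h'.trans h.symm) (hG.disjoint _ e)
  · exact ⟨by simp [G.ne_of_adj e, G.ne_of_adj e'], hG.child e e' (h.trans h'.symm)⟩

theorem Compatible.one_mem_patternSpace [DecidableEq I] {G : ColouredDAG I C}
    (hG : G.Compatible) : (1 : Matrix I I ℝ) ∈ G.patternSpace := by
  refine ⟨fun i j h _ => Matrix.one_apply_ne h, fun i j k l s h h' => ?_⟩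
  simp only [Matrix.one_apply, (hG.of_hasColour h h').1]

variable [Fintype I]

/-- A Gram matrix determines its pattern factor up to the diagonal. -/
theorem eq_of_gram_eq {G : ColouredDAG I C} {p q : Matrix I I ℝ} (hp : p ∈ G.patternSpace)
    (hq : q ∈ G.patternSpace) (hdiag : ∀ i, p i i = q i i) (hne : ∀ i, p i i ≠ 0)
    (h : pᵀ * p = qᵀ * q) : p = q := by
  obtain ⟨f, hf⟩ := G.exists_depth
  have key : ∀ N i, (Finset.univ.sup f) - f i = N → ∀ j, p i j = q i j := by
    intro N
    induction N using Nat.strong_induction_on with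
    | _ N ih =>
      intro i hi j
      have h0 : ∑ k, (p k i * p k j - q k i * q k j) = 0 := by
        have := congrFun (congrFun h i) j
        simp only [Matrix.mul_apply, Matrix.transpose_apply] at this
        rw [Finset.sum_sub_distrib, this, sub_self]
      rw [Finset.sum_eq_single i _ (by simp)] at h0
      · rw [← hdiag i, ← mul_sub] at h0
        exact sub_eq_zero.mp ((mul_eq_zero.mp h0).resolve_left (hne i))
      · intro k _ hki
        by_cases hadj : G.Adj i k
        · have h1 := hf hadj
          have h2 : f k ≤ Finset.univ.sup f := Finset.le_sup (Finset.mem_univ k)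
          have := ih _ (by omega) k rfl
          rw [this i, this j, sub_self]
        · rw [hp.1 k i hki hadj, hq.1 k i hki hadj, zero_mul, zero_mul, sub_self]
  ext i j
  exact key _ i rfl j

variable [DecidableEq I]

theorem Compatible.diagonal_mul_mem_patternSpace {G : ColouredDAG I C} (hG : G.Compatible)
    {d : I → ℝ} (hd : ∀ i k, G.vertexColour i = G.vertexColour k → d i = d k)
    {a : Matrix I I ℝ} (ha : a ∈ G.patternSpace) :
    Matrix.diagonal d * a ∈ G.patternSpace := by
  refine ⟨fun i j h h' => ?_, fun i j k l s h h' => ?_⟩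
  · rw [Matrix.diagonal_mul, ha.1 i j h h', mul_zero]
  · rw [Matrix.diagonal_mul, Matrix.diagonal_mul, ha.2 i j k l s h h',
      hd i k (hG.of_hasColour h h').2]

theorem det_of_mem_patternSpace {G : ColouredDAG I C} {a : Matrix I I ℝ}
    (ha : a ∈ G.patternSpace) : a.det = ∏ i, a i i := by
  obtain ⟨f, hf⟩ := G.exists_depth
  have htri : a.BlockTriangular (fun i => OrderDual.toDual (f i)) := by
    intro i j hij
    have hij : f i < f j := hij
    exact ha.1 i j (by rintro rfl; exact hij.false) fun h => (hf h).asymm hij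
  have hblock : ∀ k, (a.toSquareBlock (fun i => OrderDual.toDual (f i)) k).det =
      ∏ i : {i // OrderDual.toDual (f i) = k}, a i i := by
    intro k
    have : a.toSquareBlock (fun i => OrderDual.toDual (f i)) k =
        Matrix.diagonal fun i : {i // OrderDual.toDual (f i) = k} => a i i := by
      ext i j
      rcases eq_or_ne i j with rfl | hij
      · simp [Matrix.toSquareBlock_def]
      · rw [Matrix.diagonal_apply_ne _ hij, Matrix.toSquareBlock_def, Matrix.of_apply]
        refine ha.1 _ _ (fun h => hij (Subtype.ext h)) fun h => (hf h).ne ?_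
        exact OrderDual.toDual.injective (j.2.trans i.2.symm)
    rw [this, Matrix.det_diagonal]
  rw [htri.det]
  simp_rw [hblock]
  rw [← Finset.prod_fiberwise_of_maps_to
    (g := fun i => OrderDual.toDual (f i)) (t := Finset.univ.image fun i => OrderDual.toDual (f i))
    (fun i hi => Finset.mem_image_of_mem _ hi)]
  refine Finset.prod_congr rfl fun k _ => ?_
  exact (Finset.prod_subtype _ (by simp) fun i => a i i).symm

/-- The RDAG model consists of the Gram matrices of the pattern matrices with positive diagonal. -/
theorem Compatible.mem_rdagModel_iff {G : ColouredDAG I C} (hG : G.Compatible)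
    {Ψ : Matrix I I ℝ} :
    Ψ ∈ G.rdagModel ↔ ∃ B ∈ G.patternSpace, (∀ i, 0 < B i i) ∧ Ψ = Bᵀ * B := by
  constructor
  · rintro ⟨Λ, ω, hsupp, hcol, hpos, hω, rfl⟩
    have hΛ0 : ∀ i, Λ i i = 0 := fun i => hsupp i i fun h => G.ne_of_adj h rfl
    have hΛ : Λ ∈ G.patternSpace := by
      refine ⟨fun i j _ => hsupp i j, fun i j k l s h h' => ?_⟩
      have hiff := (hG.of_hasColour h h').1
      rcases eq_or_ne i j with hij | hij
      · obtain rfl := hiff.mp hij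
        obtain rfl := hij
        rw [hΛ0, hΛ0]
      · obtain ⟨e, he⟩ := exists_adj_of_ne h hij
        obtain ⟨e', he'⟩ := exists_adj_of_ne h' (mt hiff.mpr hij)
        exact hcol e e' (he.trans he'.symm)
    refine ⟨Matrix.diagonal (fun i => (√(ω i))⁻¹) * (1 - Λ),
      hG.diagonal_mul_mem_patternSpace (fun i k h => by rw [hω i k h])
        (sub_mem hG.one_mem_patternSpace hΛ), fun i => ?_, ?_⟩
    · rw [Matrix.diagonal_mul, Matrix.sub_apply, Matrix.one_apply_eq, hΛ0, sub_zero, mul_one]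
      exact inv_pos.mpr (Real.sqrt_pos.mpr (hpos i))
    · have hinv : (Matrix.diagonal ω)⁻¹ =
          Matrix.diagonal (fun i => (√(ω i))⁻¹) * Matrix.diagonal (fun i => (√(ω i))⁻¹) := by
        refine Matrix.inv_eq_right_inv ?_
        rw [Matrix.diagonal_mul_diagonal, Matrix.diagonal_mul_diagonal, ← Matrix.diagonal_one]
        congr 1
        funext i
        rw [← mul_inv, Real.mul_self_sqrt (hpos i).le, mul_inv_cancel₀ (hpos i).ne']
      rw [hinv, Matrix.transpose_mul, Matrix.diagonal_transpose]
      simp only [Matrix.mul_assoc]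
  · rintro ⟨B, hB, hpos, rfl⟩
    have hΛ : 1 - Matrix.diagonal (fun i => (B i i)⁻¹) * B ∈ G.patternSpace :=
      sub_mem hG.one_mem_patternSpace (hG.diagonal_mul_mem_patternSpace
        (fun i k h => by rw [diag_eq_of_mem_patternSpace hB h]) hB)
    refine ⟨1 - Matrix.diagonal (fun i => (B i i)⁻¹) * B, fun i => ((B i i)⁻¹) ^ 2,
      fun i j h => ?_, fun j i l k h h' hc => ?_, fun i => pow_pos (inv_pos.mpr (hpos i)) 2,
      fun i k h => by simp only [diag_eq_of_mem_patternSpace hB h], ?_⟩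
    · rcases eq_or_ne i j with rfl | hij
      · rw [Matrix.sub_apply, Matrix.one_apply_eq, Matrix.diagonal_mul,
          inv_mul_cancel₀ (hpos i).ne', sub_self]
      · exact hΛ.1 i j hij h
    · exact hΛ.2 i j k l _ (Or.inr ⟨h, rfl⟩) (Or.inr ⟨h', hc.symm⟩)
    · have hinv : (Matrix.diagonal fun i => ((B i i)⁻¹) ^ 2)⁻¹ =
          Matrix.diagonal (fun i => B i i) * Matrix.diagonal (fun i => B i i) := by
        refine Matrix.inv_eq_right_inv ?_
        rw [Matrix.diagonal_mul_diagonal, Matrix.diagonal_mul_diagonal, ← Matrix.diagonal_one]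
        congr 1
        funext i
        have := (hpos i).ne'
        field_simp
      have hB' : Matrix.diagonal (fun i => B i i) *
          (Matrix.diagonal (fun i => (B i i)⁻¹) * B) = B := by
        rw [← Matrix.mul_assoc, Matrix.diagonal_mul_diagonal]
        simp [(hpos _).ne']
      rw [sub_sub_cancel, hinv]
      nth_rewrite 1 2 [← hB']
      rw [Matrix.transpose_mul (Matrix.diagonal fun i => B i i), Matrix.diagonal_transpose]
      simp only [Matrix.mul_assoc]

end ColouredDAG

section Likelihood

variable {I : Type*} [Fintype I] [DecidableEq I] {n : ℕ}

theorem gaussianDensity_gram (B : Matrix I I ℝ) (y : I → ℝ) :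
    gaussianDensity (Bᵀ * B) y = (√((2 * Real.pi) ^ Fintype.card I))⁻¹ * |B.det| *
      Real.exp (-(1 / 2) * ∑ i, (B *ᵥ y) i ^ 2) := by
  have hquad : y ⬝ᵥ (Bᵀ * B) *ᵥ y = ∑ i, (B *ᵥ y) i ^ 2 := by
    rw [← Matrix.mulVec_mulVec, Matrix.dotProduct_mulVec, Matrix.vecMul_transpose]
    simp [dotProduct, sq]
  have hdet : ((2 * Real.pi) • (Bᵀ * B)⁻¹).det =
      (2 * Real.pi) ^ Fintype.card I * (B.det ^ 2)⁻¹ := by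
    rw [Matrix.det_smul, Matrix.det_nonsing_inv, Matrix.det_mul, Matrix.det_transpose, ← sq,
      Ring.inverse_eq_inv']
  rw [gaussianDensity, hquad, hdet, Real.sqrt_mul (by positivity), Real.sqrt_inv,
    Real.sqrt_sq_eq_abs, one_div, mul_inv, inv_inv]

theorem likelihood_gram (B : Matrix I I ℝ) (Y : Matrix I (Fin n) ℝ) :
    likelihood Y (Bᵀ * B) = ((√((2 * Real.pi) ^ Fintype.card I))⁻¹) ^ n * (|B.det| ^ n *
      Real.exp (-(1 / 2) * ∑ t, ∑ i, (B * Y) i t ^ 2)) := by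
  have : ∀ t, gaussianDensity (Bᵀ * B) (fun i => Y i t) =
      (√((2 * Real.pi) ^ Fintype.card I))⁻¹ * |B.det| *
        Real.exp (-(1 / 2) * ∑ i, (B * Y) i t ^ 2) := fun t => by
    rw [gaussianDensity_gram]; rfl
  simp only [likelihood, this]
  rw [Finset.prod_mul_distrib, ← Real.exp_sum, ← Finset.mul_sum, Finset.prod_const,
    Finset.card_univ, Fintype.card_fin, mul_pow, mul_assoc]

theorem likelihood_gram_le_iff {B B' : Matrix I I ℝ} (hB : B.det ≠ 0) (hB' : B'.det ≠ 0)
    (Y : Matrix I (Fin n) ℝ) :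
    likelihood Y (Bᵀ * B) ≤ likelihood Y (B'ᵀ * B') ↔
      n * Real.log |B.det| - (1 / 2) * ∑ t, ∑ i, (B * Y) i t ^ 2 ≤
        n * Real.log |B'.det| - (1 / 2) * ∑ t, ∑ i, (B' * Y) i t ^ 2 := by
  have hexp : ∀ {M : Matrix I I ℝ}, M.det ≠ 0 →
      |M.det| ^ n * Real.exp (-(1 / 2) * ∑ t, ∑ i, (M * Y) i t ^ 2) =
      Real.exp (n * Real.log |M.det| - (1 / 2) * ∑ t, ∑ i, (M * Y) i t ^ 2) := fun {M} hM => by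
    rw [sub_eq_add_neg, Real.exp_add, Real.exp_nat_mul, Real.exp_log (abs_pos.mpr hM), neg_mul]
  rw [likelihood_gram, likelihood_gram, hexp hB, hexp hB',
    mul_le_mul_iff_right₀ (by positivity), Real.exp_le_exp]

end Likelihood

theorem Real.add_log_le_two_mul_log_midpoint {x y : ℝ} (hx : 0 < x) (hy : 0 < y) :
    Real.log x + Real.log y ≤ 2 * Real.log ((x + y) / 2) ∧
      (Real.log x + Real.log y = 2 * Real.log ((x + y) / 2) → x = y) := by
  have hm : 0 < (x + y) / 2 := by positivity
  have hlog : 2 * Real.log ((x + y) / 2) = Real.log (((x + y) / 2) ^ 2) := by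
    rw [Real.log_pow]; norm_num
  rw [hlog, ← Real.log_mul hx.ne' hy.ne']
  refine ⟨Real.log_le_log (by positivity) (by nlinarith [sq_nonneg (x - y)]), fun h => ?_⟩
  have h' := Real.log_injOn_pos (Set.mem_Ioi.mpr (mul_pos hx hy))
    (Set.mem_Ioi.mpr (pow_pos hm 2)) h
  have : (x - y) ^ 2 = 0 := by nlinarith
  exact sub_eq_zero.mp (pow_eq_zero_iff two_ne_zero |>.mp this)

namespace ColouredDAG

variable {I C : Type*} [Fintype I] {n : ℕ}

/-- The log-likelihood of `Bᵀ * B`, up to an additive constant, where `B` is a pattern matrix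
with positive diagonal. -/
noncomputable def logLikelihood (Y : Matrix I (Fin n) ℝ) (B : Matrix I I ℝ) : ℝ :=
  n * ∑ i, Real.log (B i i) - (1 / 2) * ∑ t, ∑ i, (B * Y) i t ^ 2

/-- By strict concavity, two maximisers of the log-likelihood have the same diagonal and the same
product with the sample matrix. -/
theorem eq_of_logLikelihood_max {G : ColouredDAG I C} (hn : 0 < n) {Y : Matrix I (Fin n) ℝ}
    {B B' : Matrix I I ℝ} (hB : B ∈ G.patternSpace) (hpos : ∀ i, 0 < B i i)
    (hB' : B' ∈ G.patternSpace) (hpos' : ∀ i, 0 < B' i i)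
    (hmax : ∀ D ∈ G.patternSpace, (∀ i, 0 < D i i) → logLikelihood Y D ≤ logLikelihood Y B)
    (hle : logLikelihood Y B ≤ logLikelihood Y B') :
    (∀ i, B i i = B' i i) ∧ B * Y = B' * Y := by
  have hmid := hmax ((1 / 2 : ℝ) • (B + B')) (Submodule.smul_mem _ _ (add_mem hB hB'))
    fun i => by
      have := hpos i
      have := hpos' i
      simp only [Matrix.smul_apply, Matrix.add_apply, smul_eq_mul]
      positivity
  have hent : ∀ i, ((1 / 2 : ℝ) • (B + B')) i i = (B i i + B' i i) / 2 := fun i => by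
    simp only [Matrix.smul_apply, Matrix.add_apply, smul_eq_mul]; ring
  have hquad : ∑ t, ∑ i, (((1 / 2 : ℝ) • (B + B')) * Y) i t ^ 2 =
      1 / 2 * ∑ t, ∑ i, (B * Y) i t ^ 2 + 1 / 2 * ∑ t, ∑ i, (B' * Y) i t ^ 2 -
        1 / 4 * ∑ t, ∑ i, ((B * Y) i t - (B' * Y) i t) ^ 2 := by
    simp only [Finset.mul_sum, ← Finset.sum_add_distrib, ← Finset.sum_sub_distrib]
    refine Finset.sum_congr rfl fun t _ => Finset.sum_congr rfl fun i _ => ?_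
    rw [Matrix.smul_mul, Matrix.add_mul, Matrix.smul_apply, Matrix.add_apply, smul_eq_mul]
    ring
  have hlog : ∀ i ∈ Finset.univ, 0 ≤ 2 * Real.log ((B i i + B' i i) / 2) -
      (Real.log (B i i) + Real.log (B' i i)) := fun i _ =>
    sub_nonneg.mpr (Real.add_log_le_two_mul_log_midpoint (hpos i) (hpos' i)).1
  have hsq : ∀ t ∈ Finset.univ, 0 ≤ ∑ i, ((B * Y) i t - (B' * Y) i t) ^ 2 := fun t _ =>
    Finset.sum_nonneg fun i _ => sq_nonneg _
  have hsum : ∑ i, (2 * Real.log ((B i i + B' i i) / 2) -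
      (Real.log (B i i) + Real.log (B' i i))) = 2 * ∑ i, Real.log ((B i i + B' i i) / 2) -
      (∑ i, Real.log (B i i) + ∑ i, Real.log (B' i i)) := by
    rw [Finset.sum_sub_distrib, Finset.sum_add_distrib, Finset.mul_sum]
  have hn' : (0 : ℝ) < n := Nat.cast_pos.mpr hn
  simp only [logLikelihood, hent, hquad] at hmid hle
  have h1 := Finset.sum_nonneg hlog
  have h2 := Finset.sum_nonneg hsq
  have h3 : (n : ℝ) * ∑ i, (2 * Real.log ((B i i + B' i i) / 2) -
      (Real.log (B i i) + Real.log (B' i i))) +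
      1 / 4 * ∑ t, ∑ i, ((B * Y) i t - (B' * Y) i t) ^ 2 ≤ 0 := by
    rw [hsum]; linarith
  have h4 := mul_nonneg hn'.le h1
  have h5 : ∑ i, (2 * Real.log ((B i i + B' i i) / 2) -
      (Real.log (B i i) + Real.log (B' i i))) = 0 :=
    (mul_eq_zero.mp (show (n : ℝ) * _ = 0 by linarith)).resolve_left hn'.ne'
  have h6 : ∑ t, ∑ i, ((B * Y) i t - (B' * Y) i t) ^ 2 = 0 := by linarith
  constructor
  · intro i
    have := (Finset.sum_eq_zero_iff_of_nonneg hlog).mp h5 i (Finset.mem_univ i)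
    exact (Real.add_log_le_two_mul_log_midpoint (hpos i) (hpos' i)).2 (sub_eq_zero.mp this).symm
  · ext i t
    have ht := (Finset.sum_eq_zero_iff_of_nonneg hsq).mp h6 t (Finset.mem_univ t)
    have := (Finset.sum_eq_zero_iff_of_nonneg fun i _ => sq_nonneg _).mp ht i (Finset.mem_univ i)
    exact sub_eq_zero.mp (pow_eq_zero_iff two_ne_zero |>.mp this)

variable [DecidableEq I]

theorem det_pos_of_mem_patternSpace {G : ColouredDAG I C} {B : Matrix I I ℝ}
    (hB : B ∈ G.patternSpace) (hpos : ∀ i, 0 < B i i) : 0 < B.det := by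
  rw [det_of_mem_patternSpace hB]
  exact Finset.prod_pos fun i _ => hpos i

theorem likelihood_le_iff_logLikelihood_le {G : ColouredDAG I C} {B B' : Matrix I I ℝ}
    (hB : B ∈ G.patternSpace) (hpos : ∀ i, 0 < B i i)
    (hB' : B' ∈ G.patternSpace) (hpos' : ∀ i, 0 < B' i i) (Y : Matrix I (Fin n) ℝ) :
    likelihood Y (Bᵀ * B) ≤ likelihood Y (B'ᵀ * B') ↔ logLikelihood Y B ≤ logLikelihood Y B' := by
  have hlog : ∀ {M : Matrix I I ℝ}, M ∈ G.patternSpace → (∀ i, 0 < M i i) →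
      Real.log |M.det| = ∑ i, Real.log (M i i) := fun {M} hM hM0 => by
    rw [abs_of_pos (det_pos_of_mem_patternSpace hM hM0), det_of_mem_patternSpace hM,
      Real.log_prod fun i _ => (hM0 i).ne']
  rw [likelihood_gram_le_iff (det_pos_of_mem_patternSpace hB hpos).ne'
    (det_pos_of_mem_patternSpace hB' hpos').ne', hlog hB hpos, hlog hB' hpos', logLikelihood,
    logLikelihood]

theorem Compatible.isMLE_gram_iff {G : ColouredDAG I C} (hG : G.Compatible)
    {B : Matrix I I ℝ} (hB : B ∈ G.patternSpace) (hpos : ∀ i, 0 < B i i)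
    (Y : Matrix I (Fin n) ℝ) :
    IsMLE G.rdagModel Y (Bᵀ * B) ↔ ∀ B' ∈ G.patternSpace, (∀ i, 0 < B' i i) →
      logLikelihood Y B' ≤ logLikelihood Y B := by
  refine ⟨fun h B' hB' hpos' => ?_, fun h => ⟨hG.mem_rdagModel_iff.mpr ⟨B, hB, hpos, rfl⟩, ?_⟩⟩
  · exact (likelihood_le_iff_logLikelihood_le hB' hpos' hB hpos Y).mp
      (h.2 _ (hG.mem_rdagModel_iff.mpr ⟨B', hB', hpos', rfl⟩))
  · intro Φ hΦ
    obtain ⟨B', hB', hpos', rfl⟩ := hG.mem_rdagModel_iff.mp hΦ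
    exact (likelihood_le_iff_logLikelihood_le hB' hpos' hB hpos Y).mpr (h B' hB' hpos')

/-- If the log-likelihood attains its maximum, pattern matrices annihilating the sample matrix
have zero diagonal. -/
theorem Compatible.diag_eq_zero_of_mul_eq_zero {G : ColouredDAG I C} (hG : G.Compatible)
    (hn : 0 < n) {Y : Matrix I (Fin n) ℝ} {B N : Matrix I I ℝ}
    (hB : B ∈ G.patternSpace) (hpos : ∀ i, 0 < B i i)
    (hmax : ∀ D ∈ G.patternSpace, (∀ i, 0 < D i i) → logLikelihood Y D ≤ logLikelihood Y B)
    (hN : N ∈ G.patternSpace) (hNY : N * Y = 0) (i : I) : N i i = 0 := by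
  have hmem : Matrix.diagonal (fun i => N i i) * N ∈ G.patternSpace :=
    hG.diagonal_mul_mem_patternSpace (fun i k h => diag_eq_of_mem_patternSpace hN h) hN
  have hent : ∀ i, (B + Matrix.diagonal (fun i => N i i) * N) i i = B i i + N i i * N i i :=
    fun i => by rw [Matrix.add_apply, Matrix.diagonal_mul]
  have hpos' : ∀ i, 0 < B i i + N i i * N i i := fun i =>
    add_pos_of_pos_of_nonneg (hpos i) (mul_self_nonneg _)
  have hle := hmax _ (add_mem hB hmem) fun i => by rw [hent]; exact hpos' i
  have hY : (B + Matrix.diagonal (fun i => N i i) * N) * Y = B * Y := by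
    rw [Matrix.add_mul, Matrix.mul_assoc, hNY, Matrix.mul_zero, add_zero]
  simp only [logLikelihood, hent, hY] at hle
  have hle' := le_of_mul_le_mul_left (sub_le_sub_iff_right _ |>.mp hle) (Nat.cast_pos.mpr hn)
  by_contra hne
  refine hle'.not_gt (Finset.sum_lt_sum (fun k _ => ?_) ⟨i, Finset.mem_univ i, ?_⟩)
  · exact Real.log_le_log (hpos k) (le_add_of_nonneg_right (mul_self_nonneg _))
  · exact Real.log_lt_log (hpos i) (lt_add_of_pos_right _ (mul_self_pos.mpr hne))

theorem mem_matrixSetSL_iff {G : ColouredDAG I C} {a : Matrix I I ℝ} :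
    a ∈ G.matrixSetSL ↔ a ∈ G.patternSpace ∧ a.det = 1 :=
  ⟨fun h => ⟨h.1.2, h.2⟩, fun h =>
    ⟨⟨(Matrix.isUnit_iff_isUnit_det a).mpr (h.2 ▸ isUnit_one), h.1⟩, h.2⟩⟩

end ColouredDAG

open ColouredDAG in
theorem propositionA3 {I C : Type*} [Fintype I] [DecidableEq I]
    (G : ColouredDAG I C) (hG : G.Compatible)
    {n : ℕ} (hn : 0 < n) (Y : Matrix I (Fin n) ℝ)
    (a : Matrix I I ℝ) (ha : a ∈ G.matrixSetSL) (r : ℝ) (hr : 0 < r)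
    (hMLE : IsMLE G.rdagModel Y (r • (a.transpose * a))) :
    Set.BijOn (fun b : Matrix I I ℝ => r • ((a + b - 1).transpose * (a + b - 1)))
      (stabilisingSet G.matrixSetSL Y) {Ψ : Matrix I I ℝ | IsMLE G.rdagModel Y Ψ} := by
  obtain ⟨haV, hadet⟩ := mem_matrixSetSL_iff.mp ha
  have ha0 : ∀ i, a i i ≠ 0 := fun i hi => one_ne_zero (α := ℝ) <| by
    rw [← hadet, det_of_mem_patternSpace haV]
    exact Finset.prod_eq_zero (Finset.mem_univ i) hi
  have hs : 0 < √r := Real.sqrt_pos.mpr hr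
  set d : I → ℝ := fun i => √r * SignType.sign (a i i) with hd
  have hd2 : ∀ i, d i * d i = r := fun i => by
    have hsign : (SignType.sign (a i i) : ℝ) * SignType.sign (a i i) = 1 := by
      rcases (ha0 i).lt_or_gt with h | h <;> simp [h]
    rw [hd, mul_mul_mul_comm, Real.mul_self_sqrt hr.le, hsign, mul_one]
  have hd0 : ∀ i, d i ≠ 0 := fun i h => hr.ne' (by rw [← hd2 i, h, zero_mul])
  have hda : ∀ i, 0 < d i * a i i := fun i => by
    rw [hd, mul_assoc, sign_mul_self]
    exact mul_pos hs (abs_pos.mpr (ha0 i))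
  have hdcol : ∀ i k, G.vertexColour i = G.vertexColour k → d i = d k := fun i k h => by
    rw [hd]
    simp only [diag_eq_of_mem_patternSpace haV h]
  have hgram : ∀ p : Matrix I I ℝ,
      (Matrix.diagonal d * p)ᵀ * (Matrix.diagonal d * p) = r • (pᵀ * p) := fun p => by
    have hdd : Matrix.diagonal d * Matrix.diagonal d = r • (1 : Matrix I I ℝ) := by
      rw [Matrix.diagonal_mul_diagonal, Matrix.smul_one_eq_diagonal]
      exact congrArg _ (funext hd2)
    rw [Matrix.transpose_mul, Matrix.diagonal_transpose, Matrix.mul_assoc,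
      ← Matrix.mul_assoc (Matrix.diagonal d), hdd, Matrix.smul_mul, Matrix.one_mul,
      Matrix.mul_smul]
  have hBV : Matrix.diagonal d * a ∈ G.patternSpace := hG.diagonal_mul_mem_patternSpace hdcol haV
  have hBpos : ∀ i, 0 < (Matrix.diagonal d * a) i i := fun i => by
    rw [Matrix.diagonal_mul]; exact hda i
  have hmax := (hG.isMLE_gram_iff hBV hBpos Y).mp (by rw [hgram]; exact hMLE)
  have hstab : ∀ b ∈ stabilisingSet G.matrixSetSL Y,
      a + b - 1 ∈ G.patternSpace ∧ (∀ i, (a + b - 1) i i = a i i) ∧ (a + b - 1) * Y = a * Y := by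
    rintro b ⟨hb, hbY⟩
    have hbV := (mem_matrixSetSL_iff.mp hb).1
    have hN := sub_mem hbV hG.one_mem_patternSpace
    have hNY : (b - 1) * Y = 0 := by rw [Matrix.sub_mul, hbY, Matrix.one_mul, sub_self]
    rw [add_sub_assoc]
    refine ⟨add_mem haV hN, fun i => ?_, by rw [Matrix.add_mul, hNY, add_zero]⟩
    rw [Matrix.add_apply, hG.diag_eq_zero_of_mul_eq_zero hn hBV hBpos hmax hN hNY i, add_zero]
  refine ⟨fun b hb => ?_, fun b hb b' hb' h => ?_, fun Ψ hΨ => ?_⟩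
  · obtain ⟨hpV, hpdiag, hpY⟩ := hstab b hb
    have hpos : ∀ i, 0 < (Matrix.diagonal d * (a + b - 1)) i i := fun i => by
      rw [Matrix.diagonal_mul, hpdiag]; exact hda i
    have hlik : logLikelihood Y (Matrix.diagonal d * (a + b - 1)) =
        logLikelihood Y (Matrix.diagonal d * a) := by
      simp only [logLikelihood, Matrix.mul_assoc, hpY, Matrix.diagonal_mul, hpdiag]
    have := (hG.isMLE_gram_iff (hG.diagonal_mul_mem_patternSpace hdcol hpV) hpos Y).mpr
      (by rw [hlik]; exact hmax)
    rwa [hgram] at this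
  · obtain ⟨hpV, hpdiag, -⟩ := hstab b hb
    obtain ⟨hqV, hqdiag, -⟩ := hstab b' hb'
    have := eq_of_gram_eq hpV hqV (fun i => (hpdiag i).trans (hqdiag i).symm)
      (fun i => by rw [hpdiag]; exact ha0 i) (smul_right_injective _ hr.ne' h)
    exact add_left_cancel (sub_left_injective this)
  · obtain ⟨B, hB, hpos, rfl⟩ := hG.mem_rdagModel_iff.mp hΨ.1
    obtain ⟨hdiag, hY⟩ := eq_of_logLikelihood_max hn hBV hBpos hB hpos hmax
      ((hG.isMLE_gram_iff hB hpos Y).mp hΨ _ hBV hBpos)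
    set p := Matrix.diagonal (fun i => (d i)⁻¹) * B with hp
    have hpV : p ∈ G.patternSpace :=
      hG.diagonal_mul_mem_patternSpace (fun i k h => by rw [hdcol i k h]) hB
    have hcancel : ∀ M : Matrix I I ℝ,
        Matrix.diagonal (fun i => (d i)⁻¹) * (Matrix.diagonal d * M) = M := fun M => by
      ext i j
      rw [Matrix.diagonal_mul, Matrix.diagonal_mul, inv_mul_cancel_left₀ (hd0 i)]
    have hdp : Matrix.diagonal d * p = B := by
      ext i j
      rw [Matrix.diagonal_mul, hp, Matrix.diagonal_mul, mul_inv_cancel_left₀ (hd0 i)]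
    have hpdiag : ∀ i, p i i = a i i := fun i => by
      rw [hp, Matrix.diagonal_mul, ← hdiag i, Matrix.diagonal_mul, inv_mul_cancel_left₀ (hd0 i)]
    have hpY : p * Y = a * Y := by
      rw [hp, Matrix.mul_assoc, ← hY, ← Matrix.mul_assoc, hcancel]
    have hbV : p - a + 1 ∈ G.patternSpace := add_mem (sub_mem hpV haV) hG.one_mem_patternSpace
    refine ⟨p - a + 1, ⟨mem_matrixSetSL_iff.mpr ⟨hbV, ?_⟩, ?_⟩, ?_⟩
    · rw [det_of_mem_patternSpace hbV]
      exact Finset.prod_eq_one fun i _ => by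
        rw [Matrix.add_apply, Matrix.sub_apply, hpdiag, sub_self, zero_add, Matrix.one_apply_eq]
    · rw [Matrix.add_mul, Matrix.sub_mul, hpY, sub_self, zero_add, Matrix.one_mul]
    · have hsum : a + (p - a + 1) - 1 = p := by abel
      simp only [hsum]
      rw [← hgram, hdp]
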